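/- A transmitter operates in slots $t=0,1,2,\dots$ of duration $\Delta t>0$. In slot $t$ the energy $E_a(t)\ge 0$ arrives and the normalized channel gain is $\gamma(t)$. A power process $\{P(t)\}$ drives the battery energy by $$E_b(t+1)=E_b(t)-\Delta t\,P(t)+E_s(t),\qquad E_s(t)=\min\{E_{\max}-(E_b(t)-\Delta t\,P(t)),\,E_a(t),\,E_{c,\max}\},$$ with $E_b(0)\in[E_{\min},E_{\max}]$ given and $0\le E_{c,\max}\le\Delta t P_{\max}$. Fix the information available to the transmitter, i.e. any filtration $(\mathcal F_t)$ to which the system state $(E_a(t),\gamma(t))$ is adapted. A power process is feasible for the problem P1 if $P(t)$ is $\mathcal F_t$-measurable, $0\le P(t)\le P_{\max}$ and $\Delta t\,P(t)\le E_b(t)-E_{\min}$ almost surely for all $t$. Let $\bar R^{\rm opt}$ be the optimal value of P1, the supremum over all feasible power processes of $$\limsup_{T\to\infty}\frac1T\sum_{t=0}^{T-1}\mathbb E\big[\log(1+P(t)\gamma(t))\big].$$ Let $\gamma_{\max}>0$, $\zeta_{\max}=\gamma_{\max}/\Delta t$, $V_{\max}=(E_{\max}-E_{\min}-E_{c,\max}-\Delta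 t P_{\max})/\zeta_{\max}$ and $B=\max\{E_{c,\max},\Delta t P_{\max}\}^2/2$. For $V>0$, Algorithm 1 uses in slot $t$ the power $$P^*(t)=\begin{cases}0,& E_b(t)<\theta_1(t),\\[2pt] \dfrac{V}{\Delta t\,(V\zeta_{\max}+\Delta tP_{\max}+E_{\min}-E_b(t))}-\dfrac1{\gamma(t)},&\theta_1(t)\le E_b(t)\le\theta_2(t),\\[2pt] P_{\max},&E_b(t)>\theta_2(t),\end{cases}$$ where $\theta_1(t)=\Delta tP_{\max}+E_{\min}+V\big(\zeta_{\max}-\frac{\gamma(t)}{\Delta t}\big)$ and $\theta_2(t)=\Delta tP_{\max}+E_{\min}+V\big(\zeta_{\max}-\frac{\gamma(t)}{\Delta t(P_{\max}\gamma(t)+1)}\big)$ (if $\gamma(t)=0$ and $E_b(t)=\theta_1(t)=\theta_2(t)$, then $P^*(t)=0$). Let $$\bar R^s(V)=\liminf_{T\to\infty}\frac1T\sum_{t=0}^{T-1}\mathbb E\big[\log(1+P^*(t)\gamma(t))\big].$$ **Theorem.** Assume that $0\le\gamma(t)\le\gamma_{\max}$ almost surely for all $t$ and that the states $(E_a(t),\gamma(t))$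 are i.i.d. over $t$. (i) For every $V\in(0,V_{\max}]$, the power process of Algorithm 1 is feasible for P1, $\bar R^{\rm opt}$ is finite, and $$\bar R^{\rm opt}-\bar R^s(V)\le\frac{B}{V}.$$ (ii) For $V=V_{\max}$, $\bar R^{\rm opt}-\bar R^s(V_{\max})\to0$ as the battery capacity $E_{\max}-E_{\min}\to\infty$, with $\Delta t$, $P_{\max}$, $E_{c,\max}$, $\gamma_{\max}$, the state process and the filtration fixed, and with any initial energies $E_b(0)\in[E_{\min},E_{\max}]$. -/

import Mathlib

open MeasureTheory ProbabilityTheory Filter Topology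

noncomputable section

namespace EnergyHarvesting

/-- Data of the battery-operated transmitter: the minimum and maximum battery energy levels, the
maximum charging amount per slot, the maximum transmit power, and the slot duration. -/
structure Battery where
  Emin : ℝ
  Emax : ℝ
  EcMax : ℝ
  PMax : ℝ
  Δt : ℝ

variable {Ω : Type*}

/-- Energy harvested into the battery at the end of a slot which starts with battery energy `Eb`,
in which the power `p` is drawn and the energy `ea` arrives. -/
def Battery.harvested (b : Battery) (Eb p ea : ℝ) : ℝ :=
  min (b.Emax - (Eb - b.Δt * p)) (min ea b.EcMax)

/-- Battery energy at the beginning of the next slot. -/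
def Battery.next (b : Battery) (Eb p ea : ℝ) : ℝ :=
  Eb - b.Δt * p + b.harvested Eb p ea

/-- Battery energy at the beginning of slot `t` under the power process `P`, the arrival process
`Ea` and the initial energy `E0`. -/
def Battery.energy (b : Battery) (E0 : ℝ) (Ea P : ℕ → Ω → ℝ) : ℕ → Ω → ℝ
  | 0, _ => E0
  | t + 1, ω => b.next (b.energy E0 Ea P t ω) (P t ω) (Ea t ω)

/-- Instantaneous rate for transmit power `p` and normalized channel gain `g`. -/
def rate (p g : ℝ) : ℝ := Real.log (1 + p * g)

/-- `P` is a feasible power control: `P t` is decided on the information `ℱ t` available in slot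
`t`, it lies between `0` and the maximum power, and it draws no more energy than the battery holds
above its minimum level. (The battery dynamics hold by construction of `Battery.energy`.) -/
structure Feasible [m : MeasurableSpace Ω] (μ : Measure Ω) (ℱ : Filtration ℕ m)
    (b : Battery) (E0 : ℝ) (Ea P : ℕ → Ω → ℝ) : Prop where
  measurable : ∀ t, Measurable[ℱ t] (P t)
  power : ∀ t, ∀ᵐ ω ∂μ, 0 ≤ P t ω ∧ P t ω ≤ b.PMax
  energy : ∀ t, ∀ᵐ ω ∂μ, b.Δt * P t ω ≤ b.energy E0 Ea P t ω - b.Emin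

/-- Expected rate averaged over the slots `0, …, T - 1`. -/
def avgRate [MeasurableSpace Ω] (μ : Measure Ω) (γ P : ℕ → Ω → ℝ) (T : ℕ) : ℝ :=
  (1 / (T : ℝ)) * ∑ t ∈ Finset.range T, ∫ ω, rate (P t ω) (γ t ω) ∂μ

/-- Upper long-term time-averaged expected rate (the limit, whenever it exists). -/
def upperRate [MeasurableSpace Ω] (μ : Measure Ω) (γ P : ℕ → Ω → ℝ) : ℝ :=
  limsup (avgRate μ γ P) atTop

/-- Lower long-term time-averaged expected rate (the limit, whenever it exists). -/
def lowerRate [MeasurableSpace Ω] (μ : Measure Ω) (γ P : ℕ → Ω → ℝ) : ℝ :=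
  liminf (avgRate μ γ P) atTop

/-- The long-term time-averaged expected rates of all feasible power controls. -/
def feasibleRates [m : MeasurableSpace Ω] (μ : Measure Ω) (ℱ : Filtration ℕ m)
    (b : Battery) (E0 : ℝ) (Ea γ : ℕ → Ω → ℝ) : Set ℝ :=
  upperRate μ γ '' {P | Feasible μ ℱ b E0 Ea P}

/-- The optimal value of the rate maximization problem. -/
def optRate [m : MeasurableSpace Ω] (μ : Measure Ω) (ℱ : Filtration ℕ m)
    (b : Battery) (E0 : ℝ) (Ea γ : ℕ → Ω → ℝ) : ℝ :=
  sSup (feasibleRates μ ℱ b E0 Ea γ)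

/-- Largest admissible weight `V` (with `ζ_max = γmax / Δt`). -/
def Battery.Vmax (b : Battery) (γmax : ℝ) : ℝ :=
  (b.Emax - b.Emin - b.EcMax - b.Δt * b.PMax) / (γmax / b.Δt)

/-- The constant in the performance bound. -/
def Battery.B (b : Battery) : ℝ := (max b.EcMax (b.Δt * b.PMax)) ^ 2 / 2

/-- Lower energy threshold of the algorithm, for channel gain `g`. -/
def Battery.th1 (b : Battery) (γmax V g : ℝ) : ℝ :=
  b.Δt * b.PMax + b.Emin + V * (γmax / b.Δt - g / b.Δt)

/-- Upper energy threshold of the algorithm, for channel gain `g`. -/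
def Battery.th2 (b : Battery) (γmax V g : ℝ) : ℝ :=
  b.Δt * b.PMax + b.Emin + V * (γmax / b.Δt - g / (b.Δt * (b.PMax * g + 1)))

/-- Transmit power chosen by the algorithm at battery energy `Eb` and channel gain `g`. For `g = 0`
the two thresholds coincide, and the (then indifferent) power at that energy level is `0`. -/
def Battery.algPower (b : Battery) (γmax V Eb g : ℝ) : ℝ :=
  if Eb < b.th1 γmax V g then 0
  else if Eb ≤ b.th2 γmax V g then
    V / (b.Δt * (V * (γmax / b.Δt) + b.Δt * b.PMax + b.Emin - Eb)) - 1 / g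
  else b.PMax

/-- Battery energy when the algorithm is run. -/
def Battery.algEnergy (b : Battery) (γmax V E0 : ℝ) (Ea γ : ℕ → Ω → ℝ) : ℕ → Ω → ℝ
  | 0, _ => E0
  | t + 1, ω =>
    b.next (b.algEnergy γmax V E0 Ea γ t ω)
      (b.algPower γmax V (b.algEnergy γmax V E0 Ea γ t ω) (γ t ω)) (Ea t ω)

/-- The power process produced by the algorithm. -/
def Battery.alg (b : Battery) (γmax V E0 : ℝ) (Ea γ : ℕ → Ω → ℝ) (t : ℕ) (ω : Ω) : ℝ :=
  b.algPower γmax V (b.algEnergy γmax V E0 Ea γ t ω) (γ t ω)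

theorem Battery.energy_alg (b : Battery) (γmax V E0 : ℝ) (Ea γ : ℕ → Ω → ℝ) (t : ℕ) (ω : Ω) :
    b.energy E0 Ea (b.alg γmax V E0 Ea γ) t ω = b.algEnergy γmax V E0 Ea γ t ω := by
  induction t with
  | zero => rfl
  | succ t ih => simp only [Battery.energy, Battery.algEnergy, ih, Battery.alg]

end EnergyHarvesting

end

namespace EnergyHarvesting

/-! Write A for `level`, S for the arrival capped at `EcMax`, and D(x) for the mean of `lagrangian`
at x. By `algPower_maximizes`, `lagrangian` is the maximum over powers p of V·rate + (A - x)(S -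
Δt·p), so D is the Lagrangian dual of maximizing V times the mean rate when mean consumption may not
exceed mean harvest; the battery energy x encodes the multiplier A - x.

Upper bound: every feasible control has rate at most D(x)/V, for every x (`Feasible.upperRate_le`).
The comparison is pathwise, since a battery cannot deliver more than its initial surplus plus the
harvest; hence the filtration plays no role.

Lower bound: V ≤ `Vmax` means A + `EcMax` ≤ `Emax`, so under the algorithm the battery never
overflows and its energy is a plain sum of increments S - Δt·p. The drift of (x - A)²/2 then yields
`lagrangian` - B ≤ V·rate plus a telescoping term (`sum_lagrangian_le`). The current energy is
independent of the current state, so it can be frozen: the mean of `lagrangian` at the running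
energy is at least inf D. Both bounds together leave the gap B/V. In (ii), B is fixed while `Vmax`
tends to infinity. -/

/-- The perturbation of the battery energy in the Lyapunov function of the algorithm. -/
noncomputable def Battery.level (b : Battery) (γmax V : ℝ) : ℝ :=
  V * (γmax / b.Δt) + b.Δt * b.PMax + b.Emin

/-- The Lagrangian of one slot at the power chosen by the algorithm at battery energy `x`, for the
arrival and the channel gain `s`. -/
noncomputable def Battery.lagrangian (b : Battery) (γmax V x : ℝ) (s : ℝ × ℝ) : ℝ :=
  V * rate (b.algPower γmax V x s.2) s.2
    + (b.level γmax V - x) * (min s.1 b.EcMax - b.Δt * b.algPower γmax V x s.2)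

variable {b : Battery} {γmax V : ℝ}

/-! ### The one-slot optimization -/

theorem log_sub_log_le {x y : ℝ} (hx : 0 < x) (hy : 0 < y) :
    Real.log x - Real.log y ≤ x / y - 1 := by
  rw [← Real.log_div hx.ne' hy.ne']
  exact Real.log_le_sub_one_of_pos (div_pos hx hy)

theorem rate_nonneg {p g : ℝ} (hp : 0 ≤ p) (hg : 0 ≤ g) : 0 ≤ rate p g :=
  Real.log_nonneg (by nlinarith [mul_nonneg hp hg])

theorem rate_le_rate {p q g h : ℝ} (hp : 0 ≤ p) (hpq : p ≤ q) (hg : 0 ≤ g) (hgh : g ≤ h) :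
    rate p g ≤ rate q h := by
  have h1 : p * g ≤ q * h := mul_le_mul hpq hgh hg (hp.trans hpq)
  exact Real.log_le_log (by nlinarith [mul_nonneg hp hg]) (by linarith)

/-- The threshold compares the price of power, (A - x)·Δt, with V·g, the slope of V·rate at power 0;
`le_th2_iff` does the same with the slope at `PMax`. -/
theorem Battery.lt_th1_iff (hΔ : 0 < b.Δt) {x g : ℝ} :
    x < b.th1 γmax V g ↔ V * g < (b.level γmax V - x) * b.Δt := by
  have : (b.level γmax V - x) * b.Δt - V * g = (b.th1 γmax V g - x) * b.Δt := by
    simp only [level, th1]; field_simp; ring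
  rw [← sub_pos, ← sub_pos (b := V * g), this, mul_pos_iff_of_pos_right hΔ]

theorem Battery.le_th2_iff (hΔ : 0 < b.Δt) (hP : 0 ≤ b.PMax) {x g : ℝ} (hg : 0 ≤ g) :
    x ≤ b.th2 γmax V g ↔ V * g / (b.PMax * g + 1) ≤ (b.level γmax V - x) * b.Δt := by
  have h0 : b.PMax * g + 1 ≠ 0 := by positivity
  have : (b.level γmax V - x) * b.Δt - V * g / (b.PMax * g + 1)
      = (b.th2 γmax V g - x) * b.Δt := by
    simp only [level, th2]; field_simp; ring
  rw [← sub_nonneg, ← sub_nonneg (b := V * g / _), this, mul_nonneg_iff_of_pos_right hΔ]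

theorem Battery.algPower_mid (x g : ℝ) :
    V / (b.Δt * (V * (γmax / b.Δt) + b.Δt * b.PMax + b.Emin - x)) - 1 / g
      = V / ((b.level γmax V - x) * b.Δt) - 1 / g := by
  rw [level, mul_comm]

theorem Battery.algPower_mem (hΔ : 0 < b.Δt) (hP : 0 ≤ b.PMax) (hV : 0 < V) {x g : ℝ}
    (hg : 0 ≤ g) : 0 ≤ b.algPower γmax V x g ∧ b.algPower γmax V x g ≤ b.PMax := by
  unfold algPower
  split_ifs with h1 h2
  · exact ⟨le_rfl, hP⟩
  · rw [algPower_mid]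
    rw [lt_th1_iff hΔ, not_lt] at h1
    rw [le_th2_iff hΔ hP hg] at h2
    set w := (b.level γmax V - x) * b.Δt
    rcases hg.eq_or_lt with rfl | hg
    -- For g = 0 the thresholds coincide; division by zero being 0, the formula returns power 0.
    · have : w = 0 := le_antisymm (by simpa using h1) (by simpa using h2)
      simp [this, hP]
    · have h0 : 0 < b.PMax * g + 1 := by positivity
      have hw : 0 < w := lt_of_lt_of_le (by positivity) h2
      rw [div_le_iff₀ h0] at h2
      constructor
      · rw [sub_nonneg, div_le_div_iff₀ hg hw]; linarith
      · rw [sub_le_iff_le_add, div_le_iff₀ hw]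
        have : (b.PMax + 1 / g) * w = w * (b.PMax * g + 1) / g := by field_simp
        rw [this, le_div_iff₀ hg]; exact h2
  · exact ⟨hP, le_rfl⟩

/-- The algorithm maximizes the Lagrangian of a slot. -/
theorem Battery.algPower_maximizes (hΔ : 0 < b.Δt) (hV : 0 < V) {x g p : ℝ}
    (hg : 0 ≤ g) (hp : 0 ≤ p) (hpP : p ≤ b.PMax) :
    V * rate p g - (b.level γmax V - x) * (b.Δt * p) ≤
      V * rate (b.algPower γmax V x g) g
        - (b.level γmax V - x) * (b.Δt * b.algPower γmax V x g) := by
  have hP := hp.trans hpP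
  have hpg : 0 < 1 + p * g := by positivity
  have hPg : 0 < 1 + b.PMax * g := by positivity
  simp only [← mul_assoc]
  unfold algPower
  split_ifs with h1 h2
  · rw [lt_th1_iff hΔ] at h1
    set w := (b.level γmax V - x) * b.Δt
    -- In each case concavity is used as the tangent bound of log at the chosen power, here 0.
    have := Real.log_le_sub_one_of_pos hpg
    simp only [rate, zero_mul, add_zero, Real.log_one, mul_zero, sub_zero]
    nlinarith [mul_le_mul_of_nonneg_left this hV.le, mul_le_mul_of_nonneg_right h1.le hp]
  · rw [algPower_mid]
    rw [lt_th1_iff hΔ, not_lt] at h1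
    rw [le_th2_iff hΔ hP hg] at h2
    set w := (b.level γmax V - x) * b.Δt
    rcases hg.eq_or_lt with rfl | hg
    · have : w = 0 := le_antisymm (by simpa using h1) (by simpa using h2)
      simp [this, rate]
    · have hw : 0 < w := lt_of_lt_of_le (by positivity) h2
      have e : 1 + (V / w - 1 / g) * g = V * g / w := by field_simp; ring
      simp only [rate, e]
      -- At the interior power, 1 + p·g equals V·g/w, so the tangent of V·rate has slope exactly w.
      have := mul_le_mul_of_nonneg_left (log_sub_log_le hpg (y := V * g / w) (by positivity)) hV.le
      have e2 : V * ((1 + p * g) / (V * g / w) - 1) = w * p - w * (V / w - 1 / g) := by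
        field_simp; ring
      rw [e2] at this
      linarith
  · rw [le_th2_iff hΔ hP hg, not_le] at h2
    set w := (b.level γmax V - x) * b.Δt
    have := mul_le_mul_of_nonneg_left (log_sub_log_le hpg hPg) hV.le
    have e2 : V * ((1 + p * g) / (1 + b.PMax * g) - 1)
        = (p - b.PMax) * (V * g / (b.PMax * g + 1)) := by
      rw [add_comm (b.PMax * g)]; field_simp; ring
    rw [e2] at this
    have := mul_le_mul_of_nonpos_left h2.le (sub_nonpos.2 hpP)
    simp only [rate]
    linarith

theorem Battery.algPower_of_level_lt (hΔ : 0 < b.Δt) (hP : 0 ≤ b.PMax) (hV : 0 < V) {x g : ℝ}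
    (hg : 0 ≤ g) (hx : b.level γmax V < x) : b.algPower γmax V x g = b.PMax := by
  have hw : (b.level γmax V - x) * b.Δt < 0 := mul_neg_of_neg_of_pos (by linarith) hΔ
  unfold algPower
  rw [if_neg, if_neg]
  · rw [le_th2_iff hΔ hP hg, not_le]
    exact hw.trans_le (by positivity)
  · rw [lt_th1_iff hΔ, not_lt]
    exact hw.le.trans (by positivity)

/-! ### Battery dynamics under the algorithm -/

/-- The algorithm draws no power from a battery which could run empty. -/
theorem Battery.algPower_energy (hΔ : 0 < b.Δt) (hP : 0 ≤ b.PMax) (hV : 0 < V) {x g : ℝ}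
    (hg : 0 ≤ g) (hgm : g ≤ γmax) (hx : b.Emin ≤ x) :
    b.Δt * b.algPower γmax V x g ≤ x - b.Emin := by
  have h2 := mul_le_mul_of_nonneg_left (algPower_mem (γmax := γmax) hΔ hP hV (x := x) hg).2 hΔ.le
  by_cases h1 : x < b.th1 γmax V g
  · simp [algPower, h1, hx]
  -- Since g ≤ `γmax`, the lower threshold leaves room for a full slot at `PMax` above `Emin`.
  · have : 0 ≤ V * (γmax / b.Δt - g / b.Δt) := by rw [← sub_div]; have := sub_nonneg.2 hgm; positivity
    simp only [th1, not_lt] at h1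
    linarith

theorem Battery.next_le_Emax (x p e : ℝ) : b.next x p e ≤ b.Emax := by
  have := min_le_left (b.Emax - (x - b.Δt * p)) (min e b.EcMax)
  simp only [next, harvested]; linarith

theorem Battery.next_le (x p e : ℝ) : b.next x p e ≤ x + (min e b.EcMax - b.Δt * p) := by
  have := min_le_right (b.Emax - (x - b.Δt * p)) (min e b.EcMax)
  simp only [next, harvested]; linarith

/-- Under the algorithm the battery never overflows. -/
theorem Battery.next_algPower (hΔ : 0 < b.Δt) (hP : 0 ≤ b.PMax) (hEcP : b.EcMax ≤ b.Δt * b.PMax)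
    (hV : 0 < V) (hA : b.level γmax V + b.EcMax ≤ b.Emax) {x g e : ℝ} (hg : 0 ≤ g)
    (hx : x ≤ b.Emax) :
    b.next x (b.algPower γmax V x g) e
      = x + (min e b.EcMax - b.Δt * b.algPower γmax V x g) := by
  have h0 := mul_nonneg hΔ.le (algPower_mem (γmax := γmax) hΔ hP hV (x := x) hg).1
  have h1 := min_le_right e b.EcMax
  have : min e b.EcMax ≤ b.Emax - (x - b.Δt * b.algPower γmax V x g) := by
    -- Below the level a full charge still fits; above it, full power drains at least as much as any
    -- charge adds.
    rcases le_or_gt x (b.level γmax V) with h | h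
    · linarith
    · rw [algPower_of_level_lt hΔ hP hV hg h]; linarith
  rw [next, harvested, min_eq_right this]; ring

variable {Ω : Type*}

theorem Battery.algEnergy_mem (hΔ : 0 < b.Δt) (hP : 0 ≤ b.PMax) (hEc : 0 ≤ b.EcMax)
    (hEcP : b.EcMax ≤ b.Δt * b.PMax)
    (hV : 0 < V) (hA : b.level γmax V + b.EcMax ≤ b.Emax) {E0 : ℝ} (h0 : b.Emin ≤ E0)
    (h0' : E0 ≤ b.Emax) {Ea γ : ℕ → Ω → ℝ} {ω : Ω} (hEa : ∀ t, 0 ≤ Ea t ω)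
    (hγ : ∀ t, 0 ≤ γ t ω ∧ γ t ω ≤ γmax) (t : ℕ) :
    b.Emin ≤ b.algEnergy γmax V E0 Ea γ t ω ∧ b.algEnergy γmax V E0 Ea γ t ω ≤ b.Emax := by
  induction t with
  | zero => exact ⟨h0, h0'⟩
  | succ t ih =>
    refine ⟨?_, next_le_Emax _ _ _⟩
    rw [algEnergy, next_algPower hΔ hP hEcP hV hA (hγ t).1 ih.2]
    have := algPower_energy hΔ hP hV (hγ t).1 (hγ t).2 ih.1
    have := le_min (hEa t) hEc
    linarith

/-! ### Measurability, independence and integrability -/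

section Measurability

theorem measurable_rate : Measurable fun s : ℝ × ℝ => rate s.1 s.2 := by
  unfold rate; fun_prop

theorem Battery.measurable_algPower : Measurable fun s : ℝ × ℝ => b.algPower γmax V s.1 s.2 := by
  unfold algPower th1 th2
  refine Measurable.ite (measurableSet_lt (by fun_prop) (by fun_prop)) measurable_const
    (Measurable.ite (measurableSet_le (by fun_prop) (by fun_prop)) (by fun_prop) measurable_const)

theorem Battery.measurable_next :
    Measurable fun s : ℝ × ℝ × ℝ => b.next s.1 s.2.1 s.2.2 := by
  unfold next harvested; fun_prop

theorem Battery.measurable_lagrangian :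
    Measurable fun s : ℝ × ℝ × ℝ => b.lagrangian γmax V s.1 s.2 := by
  have h : Measurable fun s : ℝ × ℝ × ℝ => b.algPower γmax V s.1 s.2.2 :=
    measurable_algPower.comp (by fun_prop : Measurable fun s : ℝ × ℝ × ℝ => (s.1, s.2.2))
  have h2 : Measurable fun s : ℝ × ℝ × ℝ => rate (b.algPower γmax V s.1 s.2.2) s.2.2 :=
    measurable_rate.comp (h.prodMk (by fun_prop))
  unfold lagrangian; fun_prop

theorem Battery.measurable_algEnergy {m : MeasurableSpace Ω} {E0 : ℝ} {Ea γ : ℕ → Ω → ℝ} {t : ℕ}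
    (h : ∀ i < t, Measurable[m] fun ω => (Ea i ω, γ i ω)) :
    Measurable[m] (b.algEnergy γmax V E0 Ea γ t) := by
  induction t with
  | zero => exact measurable_const
  | succ t ih =>
    have h1 := ih fun i hi => h i (hi.trans t.lt_succ_self)
    have h2 := h t t.lt_succ_self
    exact measurable_next.comp (h1.prodMk ((measurable_algPower.comp (h1.prodMk h2.snd)).prodMk
      h2.fst))

end Measurability

/-- The battery energy is independent of the current state, if the states are independent. -/
theorem Battery.indepFun_algEnergy [m : MeasurableSpace Ω] {μ : Measure Ω}
    {E0 : ℝ} {Ea γ : ℕ → Ω → ℝ}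
    (hs : ∀ t, Measurable fun ω => (Ea t ω, γ t ω))
    (hindep : iIndepFun (fun t ω => (Ea t ω, γ t ω)) μ) (t : ℕ) :
    IndepFun (b.algEnergy γmax V E0 Ea γ t) (fun ω => (Ea t ω, γ t ω)) μ := by
  -- The energy at time t is a function of the states strictly before t.
  have key := indep_iSup_of_disjoint (fun i => (hs i).comap_le) hindep.iIndep
    (S := {i | i < t}) (T := {t}) (by simp)
  rw [IndepFun_iff_Indep]
  refine indep_of_indep_of_le_left (indep_of_indep_of_le_right key ?_) ?_
  · exact le_iSup₂_of_le t rfl le_rfl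
  · refine Measurable.comap_le (measurable_algEnergy fun i hi => ?_)
    exact (comap_measurable _).mono (le_iSup₂_of_le i hi le_rfl) le_rfl

/-- Freezing a random variable which is independent of the other argument. -/
theorem le_integral_of_indepFun [MeasurableSpace Ω] {μ : Measure Ω} [IsProbabilityMeasure μ]
    {α β : Type*} [MeasurableSpace α] [MeasurableSpace β] {X : Ω → α} {Y : Ω → β}
    (hX : Measurable X) (hY : Measurable Y) (hXY : IndepFun X Y μ) {h : α × β → ℝ}
    (hh : Measurable h) (hint : Integrable (fun ω => h (X ω, Y ω)) μ) {c : ℝ}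
    (hc : ∀ x, c ≤ ∫ ω, h (x, Y ω) ∂μ) : c ≤ ∫ ω, h (X ω, Y ω) ∂μ := by
  have hmap := (indepFun_iff_map_prod_eq_prod_map_map hX.aemeasurable hY.aemeasurable).1 hXY
  have := Measure.isProbabilityMeasure_map (μ := μ) hX.aemeasurable
  have := Measure.isProbabilityMeasure_map (μ := μ) hY.aemeasurable
  have hint' : Integrable h ((μ.map X).prod (μ.map Y)) := by
    rw [← hmap]
    exact (integrable_map_measure hh.aestronglyMeasurable (hX.prodMk hY).aemeasurable).2 hint
  rw [← integral_map (hX.prodMk hY).aemeasurable hh.aestronglyMeasurable (f := h), hmap,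
    integral_prod _ hint']
  calc c = ∫ _, c ∂(μ.map X) := by simp
    _ ≤ _ := integral_mono (integrable_const _) hint'.integral_prod_left fun x => by
        change c ≤ ∫ y, h (x, y) ∂(μ.map Y)
        rw [integral_map (f := fun y => h (x, y)) hY.aemeasurable
          (hh.comp measurable_prodMk_left).aestronglyMeasurable]
        exact hc x

theorem integrable_of_mem_Icc [MeasurableSpace Ω] {μ : Measure Ω} [IsFiniteMeasure μ]
    {f : Ω → ℝ} (hf : Measurable f) {c d : ℝ} (h : ∀ᵐ ω ∂μ, c ≤ f ω ∧ f ω ≤ d) :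
    Integrable f μ :=
  Integrable.of_mem_Icc c d hf.aemeasurable h

theorem integrable_rate [MeasurableSpace Ω] {μ : Measure Ω} [IsFiniteMeasure μ]
    {p g : Ω → ℝ} (hp : Measurable p) (hg : Measurable g) {P G : ℝ}
    (h : ∀ᵐ ω ∂μ, 0 ≤ p ω ∧ p ω ≤ P) (h' : ∀ᵐ ω ∂μ, 0 ≤ g ω ∧ g ω ≤ G) :
    Integrable (fun ω => rate (p ω) (g ω)) μ := by
  refine integrable_of_mem_Icc (c := 0) (d := rate P G) (measurable_rate.comp (hp.prodMk hg)) ?_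
  filter_upwards [h, h'] with ω h1 h2
  exact ⟨rate_nonneg h1.1 h2.1, rate_le_rate h1.1 h1.2 h2.1 h2.2⟩

theorem avgRate_mem [MeasurableSpace Ω] {μ : Measure Ω} [IsProbabilityMeasure μ]
    {p g : ℕ → Ω → ℝ} (hp : ∀ t, Measurable (p t)) (hg : ∀ t, Measurable (g t)) {P G : ℝ}
    (hP : 0 ≤ P) (hG : 0 ≤ G)
    (h : ∀ t, ∀ᵐ ω ∂μ, 0 ≤ p t ω ∧ p t ω ≤ P) (h' : ∀ t, ∀ᵐ ω ∂μ, 0 ≤ g t ω ∧ g t ω ≤ G) (T : ℕ) :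
    0 ≤ avgRate μ g p T ∧ avgRate μ g p T ≤ rate P G := by
  have h0 : ∀ t, 0 ≤ ∫ ω, rate (p t ω) (g t ω) ∂μ := fun t => by
    apply integral_nonneg_of_ae
    filter_upwards [h t, h' t] with ω h1 h2
    exact rate_nonneg h1.1 h2.1
  have h1 : ∀ t, ∫ ω, rate (p t ω) (g t ω) ∂μ ≤ rate P G := fun t => by
    calc _ ≤ ∫ _, rate P G ∂μ := by
          apply integral_mono_ae (integrable_rate (hp t) (hg t) (h t) (h' t)) (integrable_const _)
          filter_upwards [h t, h' t] with ω h1 h2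
          exact rate_le_rate h1.1 h1.2 h2.1 h2.2
      _ = _ := by simp
  unfold avgRate
  refine ⟨mul_nonneg (by positivity) (Finset.sum_nonneg fun t _ => h0 t), ?_⟩
  rcases T.eq_zero_or_pos with rfl | hT
  · simpa using rate_nonneg hP hG
  · have hT' : (0 : ℝ) < T := by exact_mod_cast hT
    rw [one_div_mul_eq_div, div_le_iff₀ hT']
    calc _ ≤ ∑ _t ∈ Finset.range T, rate P G := Finset.sum_le_sum fun t _ => h1 t
      _ = _ := by simp [mul_comm]

end EnergyHarvesting

/-! ### Long-term averages and standing assumptions -/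

namespace EnergyHarvesting

/-- A boundary term C that does not grow with T vanishes after division by T; the lower bound on u
keeps the real-valued limsup from being a junk value. -/
theorem limsup_le_of_mul_le {u : ℕ → ℝ} {M d C : ℝ} (hu : ∀ T, 0 ≤ u T ∧ u T ≤ M)
    (h : ∀ T : ℕ, T * u T ≤ T * d + C) : limsup u atTop ≤ d := by
  have hlim : Tendsto (fun T : ℕ => d + C / T) atTop (𝓝 d) := by
    simpa using tendsto_const_nhds.add (tendsto_const_div_atTop_nhds_zero_nat C)
  rw [← hlim.limsup_eq]
  refine limsup_le_limsup ?_ (isCoboundedUnder_le_of_le atTop fun T => (hu T).1)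
    hlim.isBoundedUnder_le
  filter_upwards [eventually_gt_atTop 0] with T hT
  have hT' : (0 : ℝ) < T := by exact_mod_cast hT
  rw [← mul_le_mul_iff_right₀ hT', mul_add, mul_div_cancel₀ _ hT'.ne']
  exact h T

theorem le_liminf_of_le_mul {u : ℕ → ℝ} {M d C : ℝ} (hu : ∀ T, 0 ≤ u T ∧ u T ≤ M)
    (h : ∀ T : ℕ, T * d ≤ T * u T + C) : d ≤ liminf u atTop := by
  have hlim : Tendsto (fun T : ℕ => d - C / T) atTop (𝓝 d) := by
    simpa using tendsto_const_nhds.sub (tendsto_const_div_atTop_nhds_zero_nat C)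
  rw [← hlim.liminf_eq]
  refine liminf_le_liminf ?_ hlim.isBoundedUnder_ge
    (isCoboundedUnder_ge_of_le atTop fun T => (hu T).2)
  filter_upwards [eventually_gt_atTop 0] with T hT
  have hT' : (0 : ℝ) < T := by exact_mod_cast hT
  rw [← mul_le_mul_iff_right₀ hT', mul_sub, mul_div_cancel₀ _ hT'.ne']
  linarith [h T]

theorem mul_avgRate {Ω : Type*} [MeasurableSpace Ω] (μ : Measure Ω) (g p : ℕ → Ω → ℝ) (T : ℕ) :
    T * avgRate μ g p T = ∑ t ∈ Finset.range T, ∫ ω, rate (p t ω) (g t ω) ∂μ := by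
  rcases T.eq_zero_or_pos with rfl | hT
  · simp
  · have hT' : (T : ℝ) ≠ 0 := by exact_mod_cast hT.ne'
    rw [avgRate, ← mul_assoc, mul_one_div_cancel hT', one_mul]

/-- Standing assumptions on the battery and the weight of the algorithm. -/
structure Battery.Admissible (b : Battery) (γmax V : ℝ) : Prop where
  slot_pos : 0 < b.Δt
  charge_nonneg : 0 ≤ b.EcMax
  charge_le : b.EcMax ≤ b.Δt * b.PMax
  weight_pos : 0 < V
  level_le : b.level γmax V + b.EcMax ≤ b.Emax

theorem Battery.Admissible.PMax_nonneg {b : Battery} {γmax V : ℝ} (h : b.Admissible γmax V) :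
    0 ≤ b.PMax :=
  nonneg_of_mul_nonneg_right (h.charge_nonneg.trans h.charge_le) h.slot_pos

/-- The states are independent and identically distributed, with nonnegative energy arrivals and
with channel gains between `0` and `γmax`. -/
structure IIDState {Ω : Type*} [MeasurableSpace Ω] (μ : Measure Ω) (γmax : ℝ)
    (Ea γ : ℕ → Ω → ℝ) : Prop where
  measurable : ∀ t, Measurable fun ω => (Ea t ω, γ t ω)
  arrival : ∀ t, ∀ᵐ ω ∂μ, 0 ≤ Ea t ω
  gain : ∀ t, ∀ᵐ ω ∂μ, 0 ≤ γ t ω ∧ γ t ω ≤ γmax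
  indep : iIndepFun (fun t ω => (Ea t ω, γ t ω)) μ
  ident : ∀ t, IdentDistrib (fun ω => (Ea t ω, γ t ω)) (fun ω => (Ea 0 ω, γ 0 ω)) μ μ

variable {Ω : Type*} [m : MeasurableSpace Ω] {μ : Measure Ω} {b : Battery}
  {γmax V E0 : ℝ} {Ea γ : ℕ → Ω → ℝ} {ℱ : Filtration ℕ m}

theorem Battery.Admissible.algEnergy_mem_ae (hb : b.Admissible γmax V) (hs : IIDState μ γmax Ea γ)
    (h0 : b.Emin ≤ E0) (h0' : E0 ≤ b.Emax) :
    ∀ᵐ ω ∂μ, ∀ t, b.Emin ≤ b.algEnergy γmax V E0 Ea γ t ω ∧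
      b.algEnergy γmax V E0 Ea γ t ω ≤ b.Emax := by
  filter_upwards [ae_all_iff.2 hs.arrival, ae_all_iff.2 hs.gain] with ω h1 h2
  exact algEnergy_mem hb.slot_pos hb.PMax_nonneg hb.charge_nonneg hb.charge_le hb.weight_pos
    hb.level_le h0 h0' h1 h2

theorem IIDState.measurable_algEnergy (hs : IIDState μ γmax Ea γ) (t : ℕ) :
    Measurable (b.algEnergy γmax V E0 Ea γ t) :=
  Battery.measurable_algEnergy fun i _ => hs.measurable i

theorem IIDState.measurable_alg (hs : IIDState μ γmax Ea γ) (t : ℕ) :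
    Measurable (b.alg γmax V E0 Ea γ t) :=
  Battery.measurable_algPower.comp ((hs.measurable_algEnergy t).prodMk (hs.measurable t).snd)

theorem Battery.Admissible.feasible_alg (hb : b.Admissible γmax V) (hs : IIDState μ γmax Ea γ)
    (hℱ : ∀ t, Measurable[ℱ t] fun ω => (Ea t ω, γ t ω))
    (h0 : b.Emin ≤ E0) (h0' : E0 ≤ b.Emax) :
    Feasible μ ℱ b E0 Ea (b.alg γmax V E0 Ea γ) where
  measurable t := by
    have h : Measurable[ℱ t] (b.algEnergy γmax V E0 Ea γ t) :=
      Battery.measurable_algEnergy fun i hi => (hℱ i).mono (ℱ.mono hi.le) le_rfl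
    exact measurable_algPower.comp (h.prodMk (hℱ t).snd)
  power t := by
    filter_upwards [hs.gain t] with ω h
    exact algPower_mem hb.slot_pos hb.PMax_nonneg hb.weight_pos h.1
  energy t := by
    filter_upwards [hs.gain t, hb.algEnergy_mem_ae hs h0 h0'] with ω h h'
    rw [energy_alg]
    exact algPower_energy hb.slot_pos hb.PMax_nonneg hb.weight_pos h.1 h.2 (h' t).1

theorem IIDState.integral_lagrangian (hs : IIDState μ γmax Ea γ) (x : ℝ) (t : ℕ) :
    ∫ ω, b.lagrangian γmax V x (Ea t ω, γ t ω) ∂μ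
      = ∫ ω, b.lagrangian γmax V x (Ea 0 ω, γ 0 ω) ∂μ :=
  ((hs.ident t).comp (Battery.measurable_lagrangian.comp measurable_prodMk_left)).integral_eq

/-! ### Pathwise duality and drift inequalities -/

/-- Lagrangian bound for an arbitrary feasible power control, up to a boundary term. -/
theorem Feasible.sum_rate_le (hb : b.Admissible γmax V) (hs : IIDState μ γmax Ea γ)
    {P : ℕ → Ω → ℝ} (hP : Feasible μ ℱ b E0 Ea P) (h0 : b.Emin ≤ E0) (x : ℝ) (T : ℕ) :
    ∀ᵐ ω ∂μ, ∑ t ∈ Finset.range T, V * rate (P t ω) (γ t ω) ≤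
      ∑ t ∈ Finset.range T, b.lagrangian γmax V x (Ea t ω, γ t ω)
        + |b.level γmax V - x| * (E0 - b.Emin) := by
  filter_upwards [ae_all_iff.2 hs.gain, ae_all_iff.2 hP.power,
    ae_all_iff.2 hP.energy] with ω hg hp he
  rcases le_or_gt x (b.level γmax V) with hx | hx
  · have hE : ∀ T, b.energy E0 Ea P T ω ≤
        E0 + ∑ t ∈ Finset.range T, (min (Ea t ω) b.EcMax - b.Δt * P t ω) := fun T => by
      induction T with
      | zero => simp [Battery.energy]
      | succ T ih =>
        rw [Finset.sum_range_succ, ← add_assoc]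
        exact (Battery.next_le _ _ _).trans (by gcongr)
    have h1 : ∑ t ∈ Finset.range T, V * rate (P t ω) (γ t ω) ≤
        ∑ t ∈ Finset.range T, (b.lagrangian γmax V x (Ea t ω, γ t ω)
          - (b.level γmax V - x) * (min (Ea t ω) b.EcMax - b.Δt * P t ω)) := by
      refine Finset.sum_le_sum fun t _ => ?_
      have := Battery.algPower_maximizes (γmax := γmax) hb.slot_pos hb.weight_pos (x := x)
        (hg t).1 (hp t).1 (hp t).2
      simp only [Battery.lagrangian]
      linarith
    rw [Finset.sum_sub_distrib] at h1
    have h2 := mul_nonneg hb.slot_pos.le (hp T).1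
    -- The energy constraint in slot T keeps the energy at time T above `Emin`.
    have h3 : b.Emin - E0 ≤ ∑ t ∈ Finset.range T, (min (Ea t ω) b.EcMax - b.Δt * P t ω) := by
      linarith [hE T, he T]
    rw [abs_of_nonneg (sub_nonneg.2 hx)]
    have := mul_le_mul_of_nonneg_left h3 (sub_nonneg.2 hx)
    rw [Finset.mul_sum] at this
    linarith
  · have h1 : ∑ t ∈ Finset.range T, V * rate (P t ω) (γ t ω) ≤
        ∑ t ∈ Finset.range T, b.lagrangian γmax V x (Ea t ω, γ t ω) := by
      refine Finset.sum_le_sum fun t _ => ?_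
      have h2 := mul_le_mul_of_nonneg_left
        (rate_le_rate (hp t).1 (hp t).2 (hg t).1 le_rfl) hb.weight_pos.le
      -- With a negative multiplier the maximizer is `PMax`, which no harvest can cover, so the
      -- multiplier term only helps.
      have h3 : 0 ≤ (b.level γmax V - x) * (min (Ea t ω) b.EcMax - b.Δt * b.PMax) :=
        mul_nonneg_of_nonpos_of_nonpos (by linarith)
          (by linarith [min_le_right (Ea t ω) b.EcMax, hb.charge_le])
      rw [Battery.lagrangian, Battery.algPower_of_level_lt hb.slot_pos hb.PMax_nonneg hb.weight_pos
        (hg t).1 hx]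
      linarith
    have := mul_nonneg (abs_nonneg (b.level γmax V - x)) (sub_nonneg.2 h0)
    linarith

/-- The drift of the quadratic Lyapunov function under the algorithm. -/
theorem Battery.Admissible.sum_lagrangian_le (hb : b.Admissible γmax V)
    (hs : IIDState μ γmax Ea γ) (h0 : b.Emin ≤ E0) (h0' : E0 ≤ b.Emax) (T : ℕ) :
    ∀ᵐ ω ∂μ, ∑ t ∈ Finset.range T,
        (b.lagrangian γmax V (b.algEnergy γmax V E0 Ea γ t ω) (Ea t ω, γ t ω) - b.B) ≤
      ∑ t ∈ Finset.range T, V * rate (b.alg γmax V E0 Ea γ t ω) (γ t ω)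
        + (E0 - b.level γmax V) ^ 2 / 2 := by
  filter_upwards [ae_all_iff.2 hs.arrival, ae_all_iff.2 hs.gain, hb.algEnergy_mem_ae hs h0 h0']
    with ω ha hg hE
  -- The final Lyapunov value is kept so that the induction closes, and dropped afterwards.
  have key : ∀ T, ∑ t ∈ Finset.range T,
        (b.lagrangian γmax V (b.algEnergy γmax V E0 Ea γ t ω) (Ea t ω, γ t ω) - b.B)
        + (b.algEnergy γmax V E0 Ea γ T ω - b.level γmax V) ^ 2 / 2 ≤
      ∑ t ∈ Finset.range T, V * rate (b.alg γmax V E0 Ea γ t ω) (γ t ω)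
        + (E0 - b.level γmax V) ^ 2 / 2 := fun T => by
    induction T with
    | zero => simp [algEnergy]
    | succ T ih =>
      rw [Finset.sum_range_succ, Finset.sum_range_succ, algEnergy,
        next_algPower hb.slot_pos hb.PMax_nonneg hb.charge_le hb.weight_pos hb.level_le (hg T).1
          (hE T).2, alg]
      have hp := algPower_mem (γmax := γmax) hb.slot_pos hb.PMax_nonneg hb.weight_pos
        (x := b.algEnergy γmax V E0 Ea γ T ω) (hg T).1
      have hL : b.lagrangian γmax V (b.algEnergy γmax V E0 Ea γ T ω) (Ea T ω, γ T ω) = V * _ + _ :=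
        rfl
      have hB : b.B = (max b.EcMax (b.Δt * b.PMax)) ^ 2 / 2 := rfl
      rw [hL]
      dsimp only
      set x := b.algEnergy γmax V E0 Ea γ T ω
      have hp1 := mul_nonneg hb.slot_pos.le hp.1
      have hp2 := mul_le_mul_of_nonneg_left hp.2 hb.slot_pos.le
      have hS := min_le_right (Ea T ω) b.EcMax
      have hS0 := le_min (ha T) hb.charge_nonneg
      set S := min (Ea T ω) b.EcMax
      set p := b.algPower γmax V x (γ T ω)
      have hM1 := le_max_left b.EcMax (b.Δt * b.PMax)
      have hM2 := le_max_right b.EcMax (b.Δt * b.PMax)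
      -- Charge and consumption are both nonnegative, so their difference is bounded by the larger
      -- cap, not the sum; this gives B.
      have hsq : (S - b.Δt * p) ^ 2 ≤ (max b.EcMax (b.Δt * b.PMax)) ^ 2 :=
        sq_le_sq' (by linarith) (by linarith)
      linarith
  have := sq_nonneg (b.algEnergy γmax V E0 Ea γ T ω - b.level γmax V)
  linarith [key T]

/-! ### Expected rates and the optimality gap -/

variable [IsProbabilityMeasure μ]

theorem Battery.Admissible.integrable_lagrangian (hb : b.Admissible γmax V)
    (hs : IIDState μ γmax Ea γ) (t : ℕ) {X : Ω → ℝ} (hX : Measurable X) {c d : ℝ}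
    (hXm : ∀ᵐ ω ∂μ, c ≤ X ω ∧ X ω ≤ d) :
    Integrable (fun ω => b.lagrangian γmax V (X ω) (Ea t ω, γ t ω)) μ := by
  have hmE := (hs.measurable t).fst
  have hmg := (hs.measurable t).snd
  have hm : Measurable fun ω => b.algPower γmax V (X ω) (γ t ω) :=
    measurable_algPower.comp (hX.prodMk hmg)
  have hp : ∀ᵐ ω ∂μ, 0 ≤ b.algPower γmax V (X ω) (γ t ω) ∧
      b.algPower γmax V (X ω) (γ t ω) ≤ b.PMax := by
    filter_upwards [hs.gain t] with ω h
    exact algPower_mem hb.slot_pos hb.PMax_nonneg hb.weight_pos h.1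
  have h1 : Integrable (fun ω => min (Ea t ω) b.EcMax
      - b.Δt * b.algPower γmax V (X ω) (γ t ω)) μ := by
    refine (integrable_of_mem_Icc (c := 0) (d := b.EcMax) (by fun_prop) ?_).sub
      ((integrable_of_mem_Icc hm hp).const_mul _)
    filter_upwards [hs.arrival t] with ω h
    exact ⟨le_min h hb.charge_nonneg, min_le_right _ _⟩
  refine ((integrable_rate hm hmg hp (hs.gain t)).const_mul V).add
    (h1.bdd_mul (c := |b.level γmax V| + max |c| |d|) (by fun_prop) ?_)
  filter_upwards [hXm] with ω h
  exact (abs_sub _ _).trans (add_le_add le_rfl (abs_le_max_abs_abs h.1 h.2))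

theorem Feasible.avgRate_mem (hb : b.Admissible γmax V) (hγ : 0 ≤ γmax)
    (hs : IIDState μ γmax Ea γ) {P : ℕ → Ω → ℝ} (hP : Feasible μ ℱ b E0 Ea P) (T : ℕ) :
    0 ≤ avgRate μ γ P T ∧ avgRate μ γ P T ≤ rate b.PMax γmax :=
  EnergyHarvesting.avgRate_mem (fun t => (hP.measurable t).mono (ℱ.le t) le_rfl)
    (fun t => (hs.measurable t).snd) hb.PMax_nonneg hγ hP.power hs.gain T

/-- Weak duality: the expected Lagrangian bounds the rate of every feasible power control. -/
theorem Feasible.upperRate_le (hb : b.Admissible γmax V) (hγ : 0 ≤ γmax)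
    (hs : IIDState μ γmax Ea γ) {P : ℕ → Ω → ℝ} (hP : Feasible μ ℱ b E0 Ea P) (h0 : b.Emin ≤ E0)
    (x : ℝ) :
    upperRate μ γ P ≤ (∫ ω, b.lagrangian γmax V x (Ea 0 ω, γ 0 ω) ∂μ) / V := by
  refine limsup_le_of_mul_le (C := |b.level γmax V - x| * (E0 - b.Emin) / V)
    (hP.avgRate_mem hb hγ hs) fun T => ?_
  have hr : ∀ t, Integrable (fun ω => V * rate (P t ω) (γ t ω)) μ := fun t =>
    (integrable_rate ((hP.measurable t).mono (ℱ.le t) le_rfl) (hs.measurable t).snd (hP.power t)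
      (hs.gain t)).const_mul V
  have hl : ∀ t, Integrable (fun ω => b.lagrangian γmax V x (Ea t ω, γ t ω)) μ := fun t =>
    hb.integrable_lagrangian hs t measurable_const (ae_of_all _ fun _ => ⟨le_rfl, le_rfl⟩)
  have hls := integrable_finsetSum (Finset.range T) fun t _ => hl t
  have h := integral_mono_ae (integrable_finsetSum (Finset.range T) fun t _ => hr t)
    (hls.add (integrable_const _)) (hP.sum_rate_le hb hs h0 x T)
  have e : ∫ ω, (∑ t ∈ Finset.range T, b.lagrangian γmax V x (Ea t ω, γ t ω)
      + |b.level γmax V - x| * (E0 - b.Emin)) ∂μ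
      = T * (∫ ω, b.lagrangian γmax V x (Ea 0 ω, γ 0 ω) ∂μ)
        + |b.level γmax V - x| * (E0 - b.Emin) := by
    rw [integral_add hls (integrable_const _), integral_finsetSum _ fun t _ => hl t]
    simp [hs.integral_lagrangian x]
  replace h := h.trans_eq e
  rw [integral_finsetSum _ fun t _ => hr t] at h
  simp only [integral_const_mul] at h
  rw [← Finset.mul_sum] at h
  rw [mul_avgRate, ← mul_div_assoc, ← add_div, le_div_iff₀' hb.weight_pos]
  exact h

/-- The algorithm reaches every lower bound of the dual function up to `B / V`. -/
theorem Battery.Admissible.le_lowerRate_alg (hb : b.Admissible γmax V) (hγ : 0 ≤ γmax)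
    (hs : IIDState μ γmax Ea γ) (h0 : b.Emin ≤ E0) (h0' : E0 ≤ b.Emax) {c : ℝ}
    (hc : ∀ x, c ≤ (∫ ω, b.lagrangian γmax V x (Ea 0 ω, γ 0 ω) ∂μ) / V) :
    c - b.B / V ≤ lowerRate μ γ (b.alg γmax V E0 Ea γ) := by
  have hV := hb.weight_pos
  have hp : ∀ t, ∀ᵐ ω ∂μ, 0 ≤ b.alg γmax V E0 Ea γ t ω ∧ b.alg γmax V E0 Ea γ t ω ≤ b.PMax :=
    fun t => by
      filter_upwards [hs.gain t] with ω h
      exact algPower_mem hb.slot_pos hb.PMax_nonneg hV h.1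
  refine le_liminf_of_le_mul (C := (E0 - b.level γmax V) ^ 2 / 2 / V)
    (avgRate_mem hs.measurable_alg (fun t => (hs.measurable t).snd) hb.PMax_nonneg hγ hp hs.gain)
    fun T => ?_
  have hr : ∀ t, Integrable (fun ω => V * rate (b.alg γmax V E0 Ea γ t ω) (γ t ω)) μ := fun t =>
    (integrable_rate (hs.measurable_alg t) (hs.measurable t).snd (hp t) (hs.gain t)).const_mul V
  have hl : ∀ t, Integrable (fun ω =>
      b.lagrangian γmax V (b.algEnergy γmax V E0 Ea γ t ω) (Ea t ω, γ t ω)) μ := fun t =>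
    hb.integrable_lagrangian hs t (hs.measurable_algEnergy t)
      ((hb.algEnergy_mem_ae hs h0 h0').mono fun ω h => h t)
  have hlB : ∀ t, Integrable (fun ω =>
      b.lagrangian γmax V (b.algEnergy γmax V E0 Ea γ t ω) (Ea t ω, γ t ω) - b.B) μ := fun t =>
    (hl t).sub (integrable_const b.B)
  have hrs := integrable_finsetSum (Finset.range T) fun t _ => hr t
  have h := integral_mono_ae (integrable_finsetSum (Finset.range T) fun t _ => hlB t)
    (hrs.add (integrable_const _)) (hb.sum_lagrangian_le hs h0 h0' T)
  have hd : ∀ t, c * V ≤ ∫ ω,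
      b.lagrangian γmax V (b.algEnergy γmax V E0 Ea γ t ω) (Ea t ω, γ t ω) ∂μ := fun t =>
    le_integral_of_indepFun (hs.measurable_algEnergy t) (hs.measurable t)
      (indepFun_algEnergy hs.measurable hs.indep t) measurable_lagrangian (hl t) fun x => by
        change _ ≤ ∫ ω, b.lagrangian γmax V x (Ea t ω, γ t ω) ∂μ
        rw [hs.integral_lagrangian x, ← le_div_iff₀ hV]
        exact hc x
  have e1 : ∫ ω, (∑ t ∈ Finset.range T, V * rate (b.alg γmax V E0 Ea γ t ω) (γ t ω)
      + (E0 - b.level γmax V) ^ 2 / 2) ∂μ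
      = V * (T * avgRate μ γ (b.alg γmax V E0 Ea γ) T) + (E0 - b.level γmax V) ^ 2 / 2 := by
    rw [integral_add hrs (integrable_const _), integral_finsetSum _ fun t _ => hr t, mul_avgRate,
      Finset.mul_sum]
    simp [integral_const_mul]
  have e2 : T * (c * V - b.B) ≤ ∫ ω, ∑ t ∈ Finset.range T,
      (b.lagrangian γmax V (b.algEnergy γmax V E0 Ea γ t ω) (Ea t ω, γ t ω) - b.B) ∂μ := by
    rw [integral_finsetSum _ fun t _ => hlB t]
    calc (T : ℝ) * (c * V - b.B) = ∑ _t ∈ Finset.range T, (c * V - b.B) := by simp [mul_sub]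
      _ ≤ _ := Finset.sum_le_sum fun t _ => by
        rw [integral_sub (hl t) (integrable_const _)]
        simpa using hd t
  have h' := (e2.trans h).trans_eq e1
  rw [← mul_le_mul_iff_right₀ hV]
  have e3 : V * (T * (c - b.B / V)) = T * (c * V - b.B) := by field_simp
  have e4 : V * (T * avgRate μ γ (b.alg γmax V E0 Ea γ) T + (E0 - b.level γmax V) ^ 2 / 2 / V)
      = V * (T * avgRate μ γ (b.alg γmax V E0 Ea γ) T) + (E0 - b.level γmax V) ^ 2 / 2 := by
    field_simp
  rw [e3, e4]
  exact h'

theorem Battery.Admissible.isLUB_optRate (hb : b.Admissible γmax V) (hγ : 0 ≤ γmax)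
    (hs : IIDState μ γmax Ea γ) (hℱ : ∀ t, Measurable[ℱ t] fun ω => (Ea t ω, γ t ω))
    (h0 : b.Emin ≤ E0) (h0' : E0 ≤ b.Emax) :
    IsLUB (feasibleRates μ ℱ b E0 Ea γ) (optRate μ ℱ b E0 Ea γ) := by
  refine isLUB_csSup ⟨_, _, hb.feasible_alg hs hℱ h0 h0', rfl⟩
    -- Any multiplier gives an upper bound; x = 0 is arbitrary.
    ⟨(∫ ω, b.lagrangian γmax V 0 (Ea 0 ω, γ 0 ω) ∂μ) / V, ?_⟩
  rintro _ ⟨P, hP, rfl⟩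
  exact hP.upperRate_le hb hγ hs h0 0

theorem Battery.Admissible.optRate_sub_le (hb : b.Admissible γmax V) (hγ : 0 ≤ γmax)
    (hs : IIDState μ γmax Ea γ) (hℱ : ∀ t, Measurable[ℱ t] fun ω => (Ea t ω, γ t ω))
    (h0 : b.Emin ≤ E0) (h0' : E0 ≤ b.Emax) :
    optRate μ ℱ b E0 Ea γ - lowerRate μ γ (b.alg γmax V E0 Ea γ) ≤ b.B / V := by
  have := hb.le_lowerRate_alg hγ hs h0 h0' (c := optRate μ ℱ b E0 Ea γ) fun x => by
    refine (hb.isLUB_optRate hγ hs hℱ h0 h0').2 ?_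
    rintro _ ⟨P, hP, rfl⟩
    exact hP.upperRate_le hb hγ hs h0 x
  linarith

theorem Battery.Admissible.optRate_sub_nonneg (hb : b.Admissible γmax V) (hγ : 0 ≤ γmax)
    (hs : IIDState μ γmax Ea γ) (hℱ : ∀ t, Measurable[ℱ t] fun ω => (Ea t ω, γ t ω))
    (h0 : b.Emin ≤ E0) (h0' : E0 ≤ b.Emax) :
    0 ≤ optRate μ ℱ b E0 Ea γ - lowerRate μ γ (b.alg γmax V E0 Ea γ) := by
  have hf := hb.feasible_alg hs hℱ h0 h0'
  have hm := hf.avgRate_mem hb hγ hs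
  have h1 : upperRate μ γ (b.alg γmax V E0 Ea γ) ≤ optRate μ ℱ b E0 Ea γ :=
    (hb.isLUB_optRate hγ hs hℱ h0 h0').1 ⟨_, hf, rfl⟩
  have h2 : lowerRate μ γ (b.alg γmax V E0 Ea γ) ≤ upperRate μ γ (b.alg γmax V E0 Ea γ) :=
    liminf_le_limsup (isBoundedUnder_of ⟨_, fun T => (hm T).2⟩)
      (isBoundedUnder_of ⟨0, fun T => (hm T).1⟩)
  linarith

theorem Battery.admissible_of_le_Vmax (hΔ : 0 < b.Δt) (hEc : 0 ≤ b.EcMax)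
    (hEcP : b.EcMax ≤ b.Δt * b.PMax) (hγ : 0 < γmax) (hV : 0 < V) (hVm : V ≤ b.Vmax γmax) :
    b.Admissible γmax V where
  slot_pos := hΔ
  charge_nonneg := hEc
  charge_le := hEcP
  weight_pos := hV
  level_le := by
    rw [Vmax, le_div_iff₀ (div_pos hγ hΔ)] at hVm
    rw [level]; linarith

end EnergyHarvesting

/-! ### The theorem -/

theorem theorem1 {Ω : Type*} [m : MeasurableSpace Ω] (μ : Measure Ω) [IsProbabilityMeasure μ]
    (Δt PMax EcMax γmax : ℝ) (hΔt : 0 < Δt) (hEc : 0 ≤ EcMax) (hEcP : EcMax ≤ Δt * PMax)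
    (hγmax : 0 < γmax)
    -- the system state: energy arrivals and normalized channel gains
    (Ea γ : ℕ → Ω → ℝ)
    (hEa : ∀ t, ∀ᵐ ω ∂μ, 0 ≤ Ea t ω)
    (hγ : ∀ t, ∀ᵐ ω ∂μ, 0 ≤ γ t ω ∧ γ t ω ≤ γmax)
    (hindep : iIndepFun (fun t ω => (Ea t ω, γ t ω)) μ)
    (hident : ∀ t, IdentDistrib (fun ω => (Ea t ω, γ t ω)) (fun ω => (Ea 0 ω, γ 0 ω)) μ μ)
    -- the information available to a power control; it contains the observed states
    (ℱ : Filtration ℕ m) (hs : ∀ t, Measurable[ℱ t] (fun ω => (Ea t ω, γ t ω))) :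
    (∀ Emin Emax E0 V : ℝ, Emin ≤ E0 → E0 ≤ Emax → 0 < V →
      V ≤ (EnergyHarvesting.Battery.mk Emin Emax EcMax PMax Δt).Vmax γmax →
      let b : EnergyHarvesting.Battery := ⟨Emin, Emax, EcMax, PMax, Δt⟩
      EnergyHarvesting.Feasible μ ℱ b E0 Ea (b.alg γmax V E0 Ea γ) ∧
      IsLUB (EnergyHarvesting.feasibleRates μ ℱ b E0 Ea γ)
        (EnergyHarvesting.optRate μ ℱ b E0 Ea γ) ∧
      EnergyHarvesting.optRate μ ℱ b E0 Ea γ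
        - EnergyHarvesting.lowerRate μ γ (b.alg γmax V E0 Ea γ) ≤ b.B / V) ∧
    (∀ Emin Emax E0 : ℕ → ℝ, (∀ n, Emin n ≤ E0 n) → (∀ n, E0 n ≤ Emax n) →
      Tendsto (fun n => Emax n - Emin n) atTop atTop →
      Tendsto (fun n =>
        let b : EnergyHarvesting.Battery := ⟨Emin n, Emax n, EcMax, PMax, Δt⟩
        EnergyHarvesting.optRate μ ℱ b (E0 n) Ea γ
          - EnergyHarvesting.lowerRate μ γ (b.alg γmax (b.Vmax γmax) (E0 n) Ea γ))
        atTop (𝓝 0)) := by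
  have hs' : EnergyHarvesting.IIDState μ γmax Ea γ :=
    ⟨fun t => (hs t).mono (ℱ.le t) le_rfl, hEa, hγ, hindep, hident⟩
  constructor
  · intro Emin Emax E0 V h0 h0' hV hVm b
    have hb : b.Admissible γmax V :=
      EnergyHarvesting.Battery.admissible_of_le_Vmax hΔt hEc hEcP hγmax hV hVm
    exact ⟨hb.feasible_alg hs' hs h0 h0', hb.isLUB_optRate hγmax.le hs' hs h0 h0',
      hb.optRate_sub_le hγmax.le hs' hs h0 h0'⟩
  · intro Emin Emax E0 h0 h0' hE
    have hV : Tendsto (fun n => (EnergyHarvesting.Battery.mk (Emin n) (Emax n) EcMax PMax Δt).Vmax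
        γmax) atTop atTop := by
      refine Tendsto.atTop_div_const (div_pos hγmax hΔt) ?_
      refine (tendsto_atTop_add_const_right _ (-(EcMax + Δt * PMax)) hE).congr fun n => ?_
      ring
    have hB := (tendsto_const_nhds (x := (max EcMax (Δt * PMax)) ^ 2 / 2)).div_atTop hV
    -- Only eventually: for small capacities `Vmax` may fail to be positive.
    have hb : ∀ᶠ n in atTop, (EnergyHarvesting.Battery.mk (Emin n) (Emax n) EcMax PMax
        Δt).Admissible γmax ((EnergyHarvesting.Battery.mk (Emin n) (Emax n) EcMax PMax Δt).Vmax
        γmax) := by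
      filter_upwards [hV.eventually_gt_atTop 0] with n hn
      exact EnergyHarvesting.Battery.admissible_of_le_Vmax hΔt hEc hEcP hγmax hn le_rfl
    refine tendsto_of_tendsto_of_tendsto_of_le_of_le' tendsto_const_nhds hB ?_ ?_
    · filter_upwards [hb] with n hn
      exact hn.optRate_sub_nonneg hγmax.le hs' hs (h0 n) (h0' n)
    · filter_upwards [hb] with n hn
      exact hn.optRate_sub_le hγmax.le hs' hs (h0 n) (h0' n)
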